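/- Conventions. The spaces $X, X', Y, Y'$ are Hausdorff, connected and locally path connected; $Y$ and $Y'$ are moreover semilocally simply connected; $B\subset Y$ and $B'\subset Y'$ are nonempty subsets; all maps are continuous, and $I=[0,1]$. For a map $f\colon X\to Y$, two points $x_0,x_1\in f^{-1}(B)$ are Nielsen equivalent if there are a path $\alpha$ in $X$ from $x_0$ to $x_1$ and a path $\beta$ in $Y$ from $f(x_0)$ to $f(x_1)$ with $\beta(I)\subset B$ such that $f\alpha$ and $\beta$ are homotopic in $Y$ relative to end points; the equivalence classes are the Nielsen classes of $f\colon X\to Y\supset B$. For a homotopy $\{f_t\}_{t\in I}\colon X\to Y$, a Nielsen class $A_0$ of $f_0$ is $\{f_t\}$-related to a Nielsen class $A_1$ of $f_1$ if there are points $x_0\in A_0$, $x_1\in A_1$, a path $\alpha$ in $X$ from $x_0$ to $x_1$ and a path $\beta$ in $Y$ from $f_0(x_0)$ to $f_1(x_1)$ with $\beta(I)\subset B$ such that the path $t\mapsto f_t(\alpha(t))$ is homotopic to $\beta$ in $Y$ relative to end points. A Nielsen class $A_0$ of $f$ is topologically essential if for every homotopy $\{f_t\}$ with $f_0=f$ there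 is a Nielsen class of $f_1$ to which $A_0$ is $\{f_t\}$-related. The topological Nielsen number $\operatorname{N_t}(f,B)\in\{0,1,2,\dots\}\cup\{\infty\}$ is the number of topologically essential Nielsen classes of $f\colon X\to Y\supset B$. Theorem. Let $f\colon X\to Y$, $f'\colon X'\to Y'$, $\varphi\colon X\to X'$ and $\psi\colon Y\to Y'$ be maps such that $\psi f$ is homotopic to $f'\varphi$. Suppose that $\psi$ is a homotopy equivalence of triples $(Y,B,Y-B)\to(Y',B',Y'-B')$, that is, $\psi(B)\subset B'$, $\psi(Y-B)\subset Y'-B'$, and there is a map $\theta\colon Y'\to Y$ with $\theta(B')\subset B$, $\theta(Y'-B')\subset Y-B$ such that $\theta\psi$ and $\psi\theta$ are homotopic to $\operatorname{id}_Y$ and $\operatorname{id}_{Y'}$ through maps of triples $(Y,B,Y-B)\to(Y,B,Y-B)$ and $(Y',B',Y'-B')\to(Y',B',Y'-B')$, respectively. Let $x_0\in X$. If $\varphi_\#\colon\pi_1(X,x_0)\to\pi_1(X',\varphi(x_0))$ is surjective, then $$\operatorname{N_t}(f,B)\le \operatorname{N_t}(f',B').$$ If moreover $\varphi$ has a right homotopy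 inverse, that is, there is a map $\chi\colon X'\to X$ with $\varphi\chi$ homotopic to $\operatorname{id}_{X'}$, then $$\operatorname{N_t}(f,B)=\operatorname{N_t}(f',B').$$ -/

import Mathlib

open Topology

namespace NielsenPreimage

universe u v w

/-- A space is semilocally simply connected if every point `x` has a neighbourhood `U` such that
every loop at `x` contained in `U` is null-homotopic (relative to end points) in the whole space. -/
def SemilocallySimplyConnected (Y : Type u) [TopologicalSpace Y] : Prop :=
  ∀ y : Y, ∃ U ∈ 𝓝 y, ∀ γ : Path y y, (∀ t, γ t ∈ U) → γ.Homotopic (Path.refl y)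

section Nielsen

variable {X : Type u} {Y : Type v} [TopologicalSpace X] [TopologicalSpace Y]

/-- For a homotopy `H = {f_t}` from `f₀` to `f₁` and a path `α` in `X` from `x₀` to `x₁`,
the path `t ↦ f_t (α t)` in `Y` from `f₀ x₀` to `f₁ x₁`. -/
def tracePath {f₀ f₁ : C(X, Y)} (H : f₀.Homotopy f₁) {x₀ x₁ : X} (α : Path x₀ x₁) :
    Path (f₀ x₀) (f₁ x₁) where
  toFun t := H (t, α t)
  continuous_toFun := by fun_prop
  source' := by simp
  target' := by simp

/-- Nielsen equivalence of points of `f ⁻¹' B`: there are a path `α` in `X` from `x₀` to `x₁` and a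
path `β` in `Y` from `f x₀` to `f x₁` that stays in `B`, such that `f ∘ α` is homotopic to `β` in
`Y` relative to end points. -/
def NielsenEquiv (f : C(X, Y)) (B : Set Y) (x₀ x₁ : X) : Prop :=
  ∃ (α : Path x₀ x₁) (β : Path (f x₀) (f x₁)),
    (∀ t, β t ∈ B) ∧ (α.map f.continuous).Homotopic β

/-- The Nielsen classes of `f : X → Y ⊇ B`: the equivalence classes of `NielsenEquiv f B`
on `f ⁻¹' B`. -/
def nielsenClasses (f : C(X, Y)) (B : Set Y) : Set (Set X) :=
  {A | ∃ x₀ ∈ f ⁻¹' B, A = {x ∈ f ⁻¹' B | NielsenEquiv f B x₀ x}}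

/-- For a homotopy `H = {f_t}`, the point `x₀` of `f₀ ⁻¹' B` is `{f_t}`-related to the point `x₁` of
`f₁ ⁻¹' B`: there are a path `α` in `X` from `x₀` to `x₁` and a path `β` from `f₀ x₀` to `f₁ x₁`
that stays in `B`, such that `t ↦ f_t (α t)` is homotopic to `β` in `Y` relative to end points. -/
def Related {f₀ f₁ : C(X, Y)} (H : f₀.Homotopy f₁) (B : Set Y) (x₀ x₁ : X) : Prop :=
  ∃ (α : Path x₀ x₁) (β : Path (f₀ x₀) (f₁ x₁)),
    (∀ t, β t ∈ B) ∧ (tracePath H α).Homotopic β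

/-- The Nielsen class `A₀` of `f₀` is `{f_t}`-related to the Nielsen class `A₁` of `f₁`. -/
def ClassRelated {f₀ f₁ : C(X, Y)} (H : f₀.Homotopy f₁) (B : Set Y) (A₀ A₁ : Set X) : Prop :=
  ∃ x₀ ∈ A₀, ∃ x₁ ∈ A₁, Related H B x₀ x₁

/-- A Nielsen class `A₀` of `f` is topologically essential if for every homotopy `{f_t}` beginning
at `f` there is a Nielsen class of `f₁` to which `A₀` is `{f_t}`-related. -/
def IsEssential (f : C(X, Y)) (B : Set Y) (A₀ : Set X) : Prop :=
  ∀ (f₁ : C(X, Y)) (H : f.Homotopy f₁), ∃ A₁ ∈ nielsenClasses f₁ B, ClassRelated H B A₀ A₁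

/-- The topological Nielsen number: the number (an integer or infinity) of topologically essential
Nielsen classes. -/
noncomputable def nielsenNumber (f : C(X, Y)) (B : Set Y) : ℕ∞ :=
  {A ∈ nielsenClasses f B | IsEssential f B A}.encard

end Nielsen

section Triples

variable {Y : Type u} {Y' : Type v} [TopologicalSpace Y] [TopologicalSpace Y']

/-- `ψ` is a map of triples `(Y, B, Y - B) → (Y', B', Y' - B')`. -/
def IsTripleMap (B : Set Y) (B' : Set Y') (ψ : C(Y, Y')) : Prop :=
  Set.MapsTo ψ B B' ∧ Set.MapsTo ψ Bᶜ B'ᶜ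

/-- `ψ` is a homotopy equivalence of triples `(Y, B, Y - B) → (Y', B', Y' - B')`: it is a map of
triples which has a homotopy inverse `θ` that is a map of triples, where the homotopies from `θ ψ`
and `ψ θ` to the identity maps go through maps of triples. -/
def IsTripleHomotopyEquiv (B : Set Y) (B' : Set Y') (ψ : C(Y, Y')) : Prop :=
  IsTripleMap B B' ψ ∧ ∃ θ : C(Y', Y), IsTripleMap B' B θ ∧
    (θ.comp ψ).HomotopicWith (ContinuousMap.id Y) (IsTripleMap B B) ∧
    (ψ.comp θ).HomotopicWith (ContinuousMap.id Y') (IsTripleMap B' B')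

end Triples

end NielsenPreimage

namespace Path.Homotopic.Quotient

variable {X Y : Type*} [TopologicalSpace X] [TopologicalSpace Y] {a b c : X}

/-! Both Nielsen relations say that some path class in `Y`, built from `f` of a class in `X` and a
homotopy track, has a representative in `B`. Such classes are closed under products and inverses, so
everything reduces to groupoid algebra plus naturality of tracks. Essentiality is pointwise, and a
relation that is total on essential points and reflects Nielsen equivalence bounds the Nielsen
numbers (`nielsenNumber_le_of_relation`). This gives homotopy invariance and invariance under
composition with `ψ`, so only `f'φ` and `f'` remain to be compared: surjectivity on `π₁` lifts path
classes along `φ`, giving `≤`; a right homotopy inverse of `φ` gives `≥`. -/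

theorem symm_trans_cancel_left (p : Path.Homotopic.Quotient a b)
    (q : Path.Homotopic.Quotient b c) : p.symm.trans (p.trans q) = q := by
  rw [← trans_assoc, symm_trans, refl_trans]

theorem trans_symm_cancel_left (p : Path.Homotopic.Quotient a b)
    (q : Path.Homotopic.Quotient a c) : p.trans (p.symm.trans q) = q := by
  rw [← trans_assoc, trans_symm, refl_trans]

theorem symm_trans_rev (p : Path.Homotopic.Quotient a b) (q : Path.Homotopic.Quotient b c) :
    (p.trans q).symm = q.symm.trans p.symm := by
  induction p using Path.Homotopic.Quotient.ind with | mk p =>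
  induction q using Path.Homotopic.Quotient.ind with | mk q =>
  rw [← mk_trans, ← mk_symm, Path.trans_symm, mk_trans, mk_symm, mk_symm]

theorem map_trans (p : Path.Homotopic.Quotient a b) (q : Path.Homotopic.Quotient b c)
    (f : C(X, Y)) : (p.trans q).map f = (p.map f).trans (q.map f) := by
  induction p using Path.Homotopic.Quotient.ind with | mk p =>
  induction q using Path.Homotopic.Quotient.ind with | mk q =>
  rw [← mk_trans, ← mk_map, Path.map_trans, mk_trans, mk_map, mk_map]

theorem map_symm (p : Path.Homotopic.Quotient a b) (f : C(X, Y)) :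
    p.symm.map f = (p.map f).symm := by
  induction p using Path.Homotopic.Quotient.ind with | mk p =>
  rw [← mk_symm, ← mk_map, ← Path.map_symm, mk_symm, mk_map]

theorem map_refl (f : C(X, Y)) : (refl a).map f = refl (f a) := rfl

/-- Naturality of the path classes traced out by a homotopy. -/
theorem map_trans_evalAt {f g : C(X, Y)} (H : f.Homotopy g) (p : Path.Homotopic.Quotient a b) :
    (p.map f).trans (mk (H.evalAt b)) = (mk (H.evalAt a)).trans (p.map g) := by
  induction p using Path.Homotopic.Quotient.ind with | mk p =>
  rw [← mk_map, ← mk_map, ← mk_trans, ← mk_trans]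
  exact eq.2 (Path.Homotopic.map_trans_evalAt H p)

theorem mk_evalAt_trans {f g h : C(X, Y)} (H : f.Homotopy g) (K : g.Homotopy h) (x : X) :
    mk ((H.trans K).evalAt x) = (mk (H.evalAt x)).trans (mk (K.evalAt x)) := by
  rw [← mk_trans]
  congr 1

end Path.Homotopic.Quotient

namespace NielsenPreimage

open Path.Homotopic (Quotient)
open Path.Homotopic.Quotient hiding symm

/-! ### Path classes representable inside a subset -/

section InSubset

variable {Y : Type*} [TopologicalSpace Y] {B : Set Y} {a b c : Y}

/-- The path class `q` has a representative which stays in `B`. -/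
def InSubset (B : Set Y) (q : Quotient a b) : Prop :=
  ∃ β : Path a b, (∀ t, β t ∈ B) ∧ mk β = q

theorem InSubset.source_mem {q : Quotient a b} (h : InSubset B q) : a ∈ B := by
  obtain ⟨β, hβ, -⟩ := h
  simpa using hβ 0

theorem InSubset.target_mem {q : Quotient a b} (h : InSubset B q) : b ∈ B := by
  obtain ⟨β, hβ, -⟩ := h
  simpa using hβ 1

theorem InSubset.refl (h : a ∈ B) : InSubset B (Path.Homotopic.Quotient.refl a) :=
  ⟨Path.refl a, fun _ => h, rfl⟩

theorem InSubset.symm {q : Quotient a b} (h : InSubset B q) : InSubset B q.symm := by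
  obtain ⟨β, hβ, rfl⟩ := h
  exact ⟨β.symm, fun t => hβ _, rfl⟩

theorem InSubset.trans {p : Quotient a b} {q : Quotient b c} (hp : InSubset B p)
    (hq : InSubset B q) : InSubset B (p.trans q) := by
  obtain ⟨β, hβ, rfl⟩ := hp
  obtain ⟨γ, hγ, rfl⟩ := hq
  refine ⟨β.trans γ, fun t => ?_, rfl⟩
  rw [Path.trans_apply]
  split_ifs
  exacts [hβ _, hγ _]

theorem InSubset.map {Y' : Type*} [TopologicalSpace Y'] {B' : Set Y'} {ψ : C(Y, Y')}
    (hψ : Set.MapsTo ψ B B') {q : Quotient a b} (hq : InSubset B q) : InSubset B' (q.map ψ) := by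
  obtain ⟨β, hβ, rfl⟩ := hq
  exact ⟨β.map ψ.continuous, fun t => hψ (hβ t), rfl⟩

end InSubset

/-! ### Nielsen relations and essentiality via path classes -/

section Relations

variable {X Y : Type*} [TopologicalSpace X] [TopologicalSpace Y] {f g f₀ f₁ f₂ : C(X, Y)}
  {B : Set Y} {x y z : X}

theorem nielsenEquiv_iff :
    NielsenEquiv f B x y ↔ ∃ α : Quotient x y, InSubset B (α.map f) := by
  constructor
  · rintro ⟨α, β, hβ, h⟩
    exact ⟨mk α, β, hβ, (eq.2 h).symm⟩
  · rintro ⟨α, β, hβ, h⟩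
    induction α using Path.Homotopic.Quotient.ind with | mk α =>
    exact ⟨α, β, hβ, exact h.symm⟩

/-- The path `t ↦ f_t (α t)` is homotopic to the concatenation of `f₀ ∘ α` and the path traced out
by the end point of `α`. -/
theorem tracePath_homotopic (H : f₀.Homotopy f₁) (α : Path x y) :
    (tracePath H α).Homotopic ((α.map f₀.continuous).trans (H.evalAt y)) := by
  set p₁ : Path ((0, x) : unitInterval × X) (1, y) := .prod .id α
  -- In `I × X`, the diagonal path `(t, α t)` deforms to running `α` at time 0, then time at `y`.
  set p₂ : Path ((0, x) : unitInterval × X) (1, y) :=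
    .prod (.trans (.refl _) .id) (.trans α (.refl _))
  set F : p₁.Homotopy p₂ := Path.Homotopic.prodHomotopy (.symm <| .reflTrans _)
    (.symm <| .transRefl _)
  refine ⟨((F.map H.toContinuousMap).pathCast (H.apply_zero x).symm (H.apply_one y).symm).cast
    ?_ ?_⟩
  · ext t
    rfl
  · ext t
    simp only [p₂, Path.cast_coe, Path.map_coe, Function.comp_apply, Path.prod_coe,
      Path.trans_apply]
    split_ifs <;> simp

theorem related_iff {H : f₀.Homotopy f₁} :
    Related H B x y ↔ ∃ α : Quotient x y, InSubset B ((α.map f₀).trans (mk (H.evalAt y))) := by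
  constructor
  · rintro ⟨α, β, hβ, h⟩
    exact ⟨mk α, β, hβ, eq.2 (h.symm.trans (tracePath_homotopic H α))⟩
  · rintro ⟨α, β, hβ, h⟩
    induction α using Path.Homotopic.Quotient.ind with | mk α =>
    exact ⟨α, β, hβ, (tracePath_homotopic H α).trans (exact h.symm)⟩

theorem NielsenEquiv.source_mem (h : NielsenEquiv f B x y) : f x ∈ B :=
  (nielsenEquiv_iff.1 h).choose_spec.source_mem

theorem NielsenEquiv.target_mem (h : NielsenEquiv f B x y) : f y ∈ B :=
  (nielsenEquiv_iff.1 h).choose_spec.target_mem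

theorem NielsenEquiv.refl (h : f x ∈ B) : NielsenEquiv f B x x :=
  nielsenEquiv_iff.2 ⟨.refl x, .refl h⟩

theorem NielsenEquiv.symm (h : NielsenEquiv f B x y) : NielsenEquiv f B y x := by
  rw [nielsenEquiv_iff] at *
  obtain ⟨α, hα⟩ := h
  exact ⟨α.symm, by simpa only [map_symm] using hα.symm⟩

theorem NielsenEquiv.trans (h : NielsenEquiv f B x y) (h' : NielsenEquiv f B y z) :
    NielsenEquiv f B x z := by
  rw [nielsenEquiv_iff] at *
  obtain ⟨α, hα⟩ := h
  obtain ⟨β, hβ⟩ := h'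
  exact ⟨α.trans β, by simpa only [map_trans] using hα.trans hβ⟩

theorem Related.source_mem {H : f₀.Homotopy f₁} (h : Related H B x y) : f₀ x ∈ B :=
  (related_iff.1 h).choose_spec.source_mem

theorem Related.target_mem {H : f₀.Homotopy f₁} (h : Related H B x y) : f₁ y ∈ B :=
  (related_iff.1 h).choose_spec.target_mem

theorem Related.nielsenEquiv_left {H : f₀.Homotopy f₁} (h : NielsenEquiv f₀ B x y)
    (h' : Related H B y z) : Related H B x z := by
  rw [related_iff] at *
  rw [nielsenEquiv_iff] at h
  obtain ⟨α, hα⟩ := h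
  obtain ⟨β, hβ⟩ := h'
  exact ⟨α.trans β, by simpa only [map_trans, trans_assoc] using hα.trans hβ⟩

theorem Related.nielsenEquiv_right {H : f₀.Homotopy f₁} (h : Related H B x y)
    (h' : NielsenEquiv f₁ B y z) : Related H B x z := by
  rw [related_iff] at *
  rw [nielsenEquiv_iff] at h'
  obtain ⟨α, hα⟩ := h
  obtain ⟨β, hβ⟩ := h'
  refine ⟨α.trans β, ?_⟩
  have := hα.trans hβ
  -- Naturality slides the track of `H` past `β`, from `y` to `z`.
  rwa [trans_assoc, ← map_trans_evalAt, ← trans_assoc, ← map_trans] at this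

/-- Two points related to the same point are Nielsen equivalent. -/
theorem Related.nielsenEquiv {H : f₀.Homotopy f₁} (h : Related H B x z) (h' : Related H B y z) :
    NielsenEquiv f₀ B x y := by
  rw [related_iff] at *
  rw [nielsenEquiv_iff]
  obtain ⟨α, hα⟩ := h
  obtain ⟨β, hβ⟩ := h'
  refine ⟨α.trans β.symm, ?_⟩
  have := hα.trans hβ.symm
  rwa [symm_trans_rev, trans_assoc, trans_symm_cancel_left, ← map_symm, ← map_trans] at this

/-- If `x` is related to `y` by `H` and to `z` by the concatenation of `H` and `K`, then `y` is
related to `z` by `K`. -/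
theorem Related.of_trans {H : f₀.Homotopy f₁} {K : f₁.Homotopy f₂} (h : Related H B x y)
    (h' : Related (H.trans K) B x z) : Related K B y z := by
  rw [related_iff] at *
  obtain ⟨α, hα⟩ := h
  obtain ⟨β, hβ⟩ := h'
  refine ⟨α.symm.trans β, ?_⟩
  have := hα.symm.trans hβ
  rwa [mk_evalAt_trans, ← trans_assoc (β.map f₀), map_trans_evalAt, map_trans_evalAt,
    symm_trans_rev, trans_assoc, trans_assoc, symm_trans_cancel_left, ← map_symm, ← trans_assoc,
    ← map_trans] at this

/-- The pointwise form of topological essentiality: under every homotopy beginning at `f`, the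
point `x` is related to some point. -/
def IsEssentialAt (f : C(X, Y)) (B : Set Y) (x : X) : Prop :=
  ∀ (f₁ : C(X, Y)) (H : f.Homotopy f₁), ∃ y, Related H B x y

theorem IsEssentialAt.mem (h : IsEssentialAt f B x) : f x ∈ B :=
  (h f (.refl f)).choose_spec.source_mem

/-- A homotopy `K` from `f₁` is tested by running `H` first. -/
theorem IsEssentialAt.of_related {H : f₀.Homotopy f₁} (h : IsEssentialAt f₀ B x)
    (hxy : Related H B x y) : IsEssentialAt f₁ B y := fun f₂ K =>
  (h f₂ (H.trans K)).imp fun _ => hxy.of_trans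

theorem isEssential_iff (hx : f x ∈ B) :
    IsEssential f B {y ∈ f ⁻¹' B | NielsenEquiv f B x y} ↔ IsEssentialAt f B x := by
  constructor
  · intro h f₁ H
    obtain ⟨A₁, -, x₀, hx₀, x₁, -, hr⟩ := h f₁ H
    exact ⟨x₁, hr.nielsenEquiv_left hx₀.2⟩
  · intro h f₁ H
    obtain ⟨y, hy⟩ := h f₁ H
    exact ⟨_, ⟨y, hy.target_mem, rfl⟩, x, ⟨hx, .refl hx⟩, y,
      ⟨hy.target_mem, .refl hy.target_mem⟩, hy⟩

end Relations

/-! ### Comparison of Nielsen numbers -/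

section Comparison

variable {X X' Y Y' : Type*} [TopologicalSpace X] [TopologicalSpace X'] [TopologicalSpace Y]
  [TopologicalSpace Y'] {B : Set Y} {B' : Set Y'}

/-- A relation which is total on essential points and reflects Nielsen equivalence gives an
inequality between Nielsen numbers. -/
theorem nielsenNumber_le_of_relation {f : C(X, Y)} {f' : C(X', Y')} (R : X → X' → Prop)
    (hR : ∀ x, IsEssentialAt f B x → ∃ x', IsEssentialAt f' B' x' ∧ R x x')
    (hinj : ∀ x y x' y', R x x' → R y y' → NielsenEquiv f' B' x' y' → NielsenEquiv f B x y) :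
    nielsenNumber f B ≤ nielsenNumber f' B' := by
  have key : ∀ A ∈ {A ∈ nielsenClasses f B | IsEssential f B A},
      ∃ A' ∈ {A' ∈ nielsenClasses f' B' | IsEssential f' B' A'}, ∃ x x', f' x' ∈ B' ∧
        A = {y ∈ f ⁻¹' B | NielsenEquiv f B x y} ∧
        A' = {y ∈ f' ⁻¹' B' | NielsenEquiv f' B' x' y} ∧ R x x' := by
    rintro A ⟨⟨x, hx, rfl⟩, hA⟩
    obtain ⟨x', h, hxx'⟩ := hR x ((isEssential_iff hx).1 hA)
    exact ⟨_, ⟨⟨x', h.mem, rfl⟩, (isEssential_iff h.mem).2 h⟩, x, x', h.mem, rfl, rfl, hxx'⟩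
  choose! F hF hF' using key
  refine Set.encard_le_encard_of_injOn (f := F) hF ?_
  intro A h A₁ h₁ heq
  obtain ⟨x, x', -, hA, hFA, hxx'⟩ := hF' A h
  obtain ⟨y, y', hy', hA₁, hFA₁, hyy'⟩ := hF' A₁ h₁
  have hmem : y' ∈ F A := by
    rw [heq, hFA₁]
    exact ⟨hy', .refl hy'⟩
  rw [hFA] at hmem
  have hN := hinj _ _ _ _ hxx' hyy' hmem.2
  rw [hA, hA₁]
  ext z
  exact and_congr_right fun _ => ⟨hN.symm.trans, hN.trans⟩

theorem nielsenNumber_le_of_homotopic {f g : C(X, Y)} (h : f.Homotopic g) :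
    nielsenNumber f B ≤ nielsenNumber g B := by
  obtain ⟨H⟩ := h
  refine nielsenNumber_le_of_relation (fun x y => Related H B x y) ?_ ?_
  · intro x hx
    obtain ⟨y, hy⟩ := hx g H
    exact ⟨y, hx.of_related hy, hy⟩
  · intro x y x' y' hx hy h
    exact (hx.nielsenEquiv_right h).nielsenEquiv hy

/-- The topological Nielsen number is a homotopy invariant. -/
theorem nielsenNumber_eq_of_homotopic {f g : C(X, Y)} (h : f.Homotopic g) :
    nielsenNumber f B = nielsenNumber g B :=
  (nielsenNumber_le_of_homotopic h).antisymm (nielsenNumber_le_of_homotopic h.symm)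

theorem IsTripleMap.mem_iff {ψ : C(Y, Y')} (h : IsTripleMap B B' ψ) {y : Y} :
    ψ y ∈ B' ↔ y ∈ B :=
  ⟨fun hy => by_contra fun hn => h.2 hn hy, fun hy => h.1 hy⟩

/-- Conjugating `θψq` by the tracks of the homotopy `θψ ≃ id` recovers `q`. The tracks stay in `B`
because both end points of `q` lie there, which is where the condition on complements enters. -/
theorem IsTripleHomotopyEquiv.inSubset_map_iff {ψ : C(Y, Y')} (h : IsTripleHomotopyEquiv B B' ψ)
    {a b : Y} (q : Quotient a b) : InSubset B' (q.map ψ) ↔ InSubset B q := by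
  obtain ⟨hψ, θ, hθ, ⟨L⟩, -⟩ := h
  refine ⟨fun hq => ?_, fun hq => hq.map hψ.1⟩
  have hL : ∀ y ∈ B, InSubset B (mk (L.toHomotopy.evalAt y)) := fun y hy =>
    ⟨_, fun t => (L.prop t).1 hy, rfl⟩
  have ha := hL a (hψ.mem_iff.1 hq.source_mem)
  have hb := hL b (hψ.mem_iff.1 hq.target_mem)
  have hθq : InSubset B (q.map (θ.comp ψ)) := by
    rw [map_comp]
    exact hq.map hθ.1
  have hq' := ha.symm.trans (hθq.trans hb)
  rw [map_trans_evalAt, symm_trans_cancel_left] at hq'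
  have hid : q.map (ContinuousMap.id Y) = q := by
    induction q using Path.Homotopic.Quotient.ind with | mk q => rfl
  rwa [hid] at hq'

theorem IsTripleHomotopyEquiv.nielsenEquiv_comp_iff {ψ : C(Y, Y')}
    (h : IsTripleHomotopyEquiv B B' ψ) {f : C(X, Y)} {x y : X} :
    NielsenEquiv (ψ.comp f) B' x y ↔ NielsenEquiv f B x y := by
  rw [nielsenEquiv_iff, nielsenEquiv_iff]
  refine exists_congr fun α => ?_
  rw [map_comp]
  exact h.inSubset_map_iff _

theorem IsTripleHomotopyEquiv.related_comp_iff {ψ : C(Y, Y')}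
    (h : IsTripleHomotopyEquiv B B' ψ) {f g : C(X, Y)} {H : f.Homotopy g} {x y : X} :
    Related ((ContinuousMap.Homotopy.refl ψ).comp H) B' x y ↔ Related H B x y := by
  rw [related_iff, related_iff]
  refine exists_congr fun α => ?_
  rw [map_comp, ← h.inSubset_map_iff, map_trans]
  rfl

theorem IsTripleHomotopyEquiv.isEssentialAt_comp_iff {ψ : C(Y, Y')}
    (h : IsTripleHomotopyEquiv B B' ψ) {f : C(X, Y)} {x : X} :
    IsEssentialAt (ψ.comp f) B' x ↔ IsEssentialAt f B x := by
  refine ⟨fun hx g H => (hx _ ((ContinuousMap.Homotopy.refl ψ).comp H)).imp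
    fun y hy => h.related_comp_iff.1 hy, fun hx g H => ?_⟩
  obtain ⟨hψ, θ, hθ, ⟨L⟩, hL'⟩ := h
  have hθe : IsTripleHomotopyEquiv B' B θ := ⟨hθ, ψ, hψ, hL', ⟨L⟩⟩
  -- `x` stays essential for `θψf`; a homotopy of `ψf` is then tested after applying `θ`, itself an
  -- equivalence of triples.
  have hrel : Related (f₁ := θ.comp (ψ.comp f)) (L.toHomotopy.symm.compContinuousMap f) B x x := by
    rw [related_iff]
    refine ⟨.refl x, ?_⟩
    rw [map_refl, refl_trans]
    exact ⟨_, fun t => (L.prop _).1 hx.mem, rfl⟩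
  obtain ⟨y, hy⟩ := hx.of_related hrel _ ((ContinuousMap.Homotopy.refl θ).comp H)
  exact ⟨y, hθe.related_comp_iff.1 hy⟩

/-- Composing with a homotopy equivalence of triples does not change the Nielsen number. -/
theorem IsTripleHomotopyEquiv.nielsenNumber_comp {ψ : C(Y, Y')}
    (h : IsTripleHomotopyEquiv B B' ψ) (f : C(X, Y)) :
    nielsenNumber (ψ.comp f) B' = nielsenNumber f B := by
  apply le_antisymm
  · refine nielsenNumber_le_of_relation Eq (fun x hx => ⟨x, h.isEssentialAt_comp_iff.1 hx, rfl⟩) ?_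
    rintro x y _ _ rfl rfl
    exact h.nielsenEquiv_comp_iff.2
  · refine nielsenNumber_le_of_relation Eq (fun x hx => ⟨x, h.isEssentialAt_comp_iff.2 hx, rfl⟩) ?_
    rintro x y _ _ rfl rfl
    exact h.nielsenEquiv_comp_iff.1

theorem nielsenEquiv_of_comp {f : C(X', Y)} {φ : C(X, X')} {x y : X}
    (h : NielsenEquiv (f.comp φ) B x y) : NielsenEquiv f B (φ x) (φ y) := by
  rw [nielsenEquiv_iff] at *
  obtain ⟨α, hα⟩ := h
  exact ⟨α.map φ, by rwa [map_comp] at hα⟩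

/-- Every homotopy of `f` restricts along `φ` to one of `fφ`, and the resulting path in `X` is
pushed forward by `φ`. -/
theorem IsEssentialAt.of_comp {f : C(X', Y)} {φ : C(X, X')} {x : X}
    (h : IsEssentialAt (f.comp φ) B x) : IsEssentialAt f B (φ x) := by
  intro g H
  obtain ⟨y, hy⟩ := h _ (H.compContinuousMap φ)
  refine ⟨φ y, ?_⟩
  rw [related_iff] at *
  obtain ⟨α, hα⟩ := hy
  refine ⟨α.map φ, ?_⟩
  rw [map_comp] at hα
  exact hα

/-- If `φ` is surjective on one fundamental group of a path connected space, then it is surjective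
on path classes between any two points of the image. -/
theorem map_surjective_of_fundamentalGroup [PathConnectedSpace X] {φ : C(X, X')} {x₀ : X}
    (hφ : Function.Surjective (FundamentalGroup.map φ x₀)) (x y : X) (q : Quotient (φ x) (φ y)) :
    ∃ p : Quotient x y, p.map φ = q := by
  let γ : Quotient x₀ x := mk (PathConnectedSpace.somePath x₀ x)
  let δ : Quotient x₀ y := mk (PathConnectedSpace.somePath x₀ y)
  obtain ⟨l, hl⟩ : ∃ l : Quotient x₀ x₀, l.map φ = ((γ.map φ).trans q).trans (δ.map φ).symm :=
    hφ (((γ.map φ).trans q).trans (δ.map φ).symm)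
  refine ⟨γ.symm.trans (l.trans δ), ?_⟩
  rw [map_trans, map_trans, hl, map_symm, trans_assoc, trans_assoc, symm_trans, trans_refl,
    symm_trans_cancel_left]

theorem nielsenNumber_comp_le [PathConnectedSpace X] (f : C(X', Y)) {φ : C(X, X')} {x₀ : X}
    (hφ : Function.Surjective (FundamentalGroup.map φ x₀)) :
    nielsenNumber (f.comp φ) B ≤ nielsenNumber f B := by
  refine nielsenNumber_le_of_relation (fun x x' => φ x = x') (fun x hx => ⟨φ x, hx.of_comp, rfl⟩) ?_
  rintro x y _ _ rfl rfl h
  rw [nielsenEquiv_iff] at *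
  obtain ⟨α, hα⟩ := h
  obtain ⟨p, rfl⟩ := map_surjective_of_fundamentalGroup hφ x y α
  exact ⟨p, by rwa [map_comp]⟩

theorem nielsenNumber_le_comp (f : C(X', Y)) {φ : C(X, X')} {χ : C(X', X)}
    (hχ : (φ.comp χ).Homotopic (ContinuousMap.id X')) :
    nielsenNumber f B ≤ nielsenNumber (f.comp φ) B := by
  obtain ⟨Q⟩ := hχ.symm
  refine nielsenNumber_le_of_relation (fun x' x => NielsenEquiv f B x' (φ x)) ?_ ?_
  · intro x' hx'
    let H : f.Homotopy ((f.comp φ).comp χ) := (ContinuousMap.Homotopy.refl f).comp Q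
    obtain ⟨y, hy⟩ := hx' _ H
    -- `y` is essential for `(fφ)χ`, hence `χ y` for `fφ`.
    refine ⟨χ y, (hx'.of_related hy).of_comp, ?_⟩
    rw [related_iff] at hy
    rw [nielsenEquiv_iff]
    obtain ⟨α, hα⟩ := hy
    -- The track of `H` at `y` is the `f`-image of the track of `Q`, which runs from `y` to `φ (χ
    -- y)`.
    refine ⟨α.trans (mk (Q.evalAt y)), ?_⟩
    rw [map_trans]
    exact hα
  · intro x y x' y' hx hy h
    exact (hx.trans (nielsenEquiv_of_comp h)).trans hy.symm

end Comparison

end NielsenPreimage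

theorem theorem4p2 {X : Type*} {X' : Type*} {Y : Type*} {Y' : Type*}
    [TopologicalSpace X] [T2Space X] [ConnectedSpace X] [LocallyPathConnectedSpace X]
    [TopologicalSpace X'] [T2Space X'] [ConnectedSpace X'] [LocallyPathConnectedSpace X']
    [TopologicalSpace Y] [T2Space Y] [ConnectedSpace Y] [LocallyPathConnectedSpace Y]
    [TopologicalSpace Y'] [T2Space Y'] [ConnectedSpace Y'] [LocallyPathConnectedSpace Y']
    (hY : NielsenPreimage.SemilocallySimplyConnected Y)
    (hY' : NielsenPreimage.SemilocallySimplyConnected Y')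
    (B : Set Y) (hB : B.Nonempty) (B' : Set Y') (hB' : B'.Nonempty)
    (f : C(X, Y)) (f' : C(X', Y')) (φ : C(X, X')) (ψ : C(Y, Y'))
    (hψ : NielsenPreimage.IsTripleHomotopyEquiv B B' ψ)
    (hcomm : (ψ.comp f).Homotopic (f'.comp φ))
    (x₀ : X) (hφ : Function.Surjective (FundamentalGroup.map φ x₀)) :
    NielsenPreimage.nielsenNumber f B ≤ NielsenPreimage.nielsenNumber f' B' ∧
      ((∃ χ : C(X', X), (φ.comp χ).Homotopic (ContinuousMap.id X')) →
        NielsenPreimage.nielsenNumber f B = NielsenPreimage.nielsenNumber f' B') := by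
  have : PathConnectedSpace X := pathConnectedSpace_iff_connectedSpace.2 inferInstance
  have hle : NielsenPreimage.nielsenNumber (f'.comp φ) B' ≤ NielsenPreimage.nielsenNumber f' B' :=
    NielsenPreimage.nielsenNumber_comp_le f' hφ
  rw [← hψ.nielsenNumber_comp f, NielsenPreimage.nielsenNumber_eq_of_homotopic hcomm]
  exact ⟨hle, fun ⟨χ, hχ⟩ => hle.antisymm (NielsenPreimage.nielsenNumber_le_comp f' hχ)⟩
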